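/- Let $X$ be a random vector in $\mathbb{R}^n$. For a linear subspace $F$ let $P_F$ be the orthogonal projection onto $F$. We say that $X$ satisfies the small ball estimate in dimension $j$ with constant $\mathcal{L}$ if for every $j$-dimensional subspace $F\subset\mathbb{R}^n$, every $z\in\mathbb{R}^n$ and every $\varepsilon>0$, $$\mathbb{P}\left(\|P_FX-z\|_2\le \varepsilon\sqrt{j}\right)\le(\mathcal{L}\varepsilon)^j ,$$ and that $X$ satisfies the small ball assumption (SBA) with constant $\mathcal{L}$ if this holds in every dimension $1\le j\le n-1$. For a linear map $T:\mathbb{R}^n\to\mathbb{R}^m$ of rank $m$ and $1\le k\le m-1$ put $$a_k(T)=\left(\int_{\mathcal{G}_{m,k}}{\det}^{-\frac12}\left[(P_FT)(P_FT)^*\right]dF\right)^{-\frac1k},$$ where $P_FT$ is regarded as a map from $\mathbb{R}^n$ to $F$, and where the integral over the Grassmannian $\mathcal{G}_{m,k}$ of $k$-dimensional subspaces of $\mathbb{R}^m$ is with respect to the Haar (rotation invariant) probability measure; also put $a_m(T)={\det}^{\frac1{2m}}(TT^*)$. There is an absolute constant $c>0$ such that the following holds. Suppose that $X$ satisfies the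 SBA with constant $\mathcal{L}$, that $T:\mathbb{R}^n\to\mathbb{R}^m$ is linear of rank $m$, and that $1\le k\le m$; if $k=m=n$, suppose in addition that $X$ satisfies the small ball estimate in dimension $n$ with constant $\mathcal{L}$. Then for every $\varepsilon>0$, $$\mathbb{P}\left(\|TX\|_2\le\varepsilon\sqrt{m}\,a_k(T)\right)\le(c\,\mathcal{L}\,\varepsilon)^k .$$ -/

import Mathlib

open MeasureTheory

noncomputable section

namespace SmallBall

/-- `ℝⁿ` with its Euclidean norm and inner product. -/
abbrev Euc (n : ℕ) : Type := EuclideanSpace ℝ (Fin n)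

section SmallBallAssumption

variable {Ω : Type*} [MeasurableSpace Ω] {n : ℕ}

/-- The small ball estimate with constant `L` for the `j`-dimensional marginals of `X`:
for every `j`-dimensional subspace `F`, every `z ∈ ℝⁿ` and every `ε > 0`,
`ℙ (‖P_F X - z‖₂ ≤ ε √j) ≤ (L ε) ^ j`. -/
def SmallBallEstimate (μ : Measure Ω) (X : Ω → Euc n) (L : ℝ) (j : ℕ) : Prop :=
  ∀ F : Submodule ℝ (Euc n), Module.finrank ℝ F = j → ∀ z : Euc n, ∀ ε : ℝ, 0 < ε →
    μ.real {ω | ‖F.starProjection (X ω) - z‖ ≤ ε * √(j : ℝ)} ≤ (L * ε) ^ j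

/-- The small ball assumption (SBA) with constant `L`: the small ball estimate holds for the
marginals of every dimension `1 ≤ j ≤ n - 1`. -/
def SBA (μ : Measure Ω) (X : Ω → Euc n) (L : ℝ) : Prop :=
  ∀ j : ℕ, 1 ≤ j → j < n → SmallBallEstimate μ X L j

end SmallBallAssumption

section OrthogonalGroup

variable (m : ℕ)

/-- The orthogonal group `O(m)`, as the group of orthogonal operators on `ℝᵐ`, with the operator
norm topology. -/
abbrev OrthGroup : Type := unitary (Euc m →L[ℝ] Euc m)

instance instContinuousStarEuc : ContinuousStar (Euc m →L[ℝ] Euc m) :=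
  ⟨(ContinuousLinearMap.adjoint (𝕜 := ℝ) (E := Euc m) (F := Euc m)).continuous⟩

instance instCompactSpaceOrthGroup : CompactSpace (OrthGroup m) := by
  apply isCompact_iff_compactSpace.mp
  refine Metric.isCompact_of_isClosed_isBounded isClosed_unitary ?_
  refine (Metric.isBounded_closedBall (x := (0 : Euc m →L[ℝ] Euc m)) (r := 1)).subset ?_
  intro U hU
  rw [mem_closedBall_zero_iff]
  refine ContinuousLinearMap.opNorm_le_bound _ zero_le_one fun x => ?_
  have h := (Unitary.linearIsometryEquiv (⟨U, hU⟩ : OrthGroup m)).norm_map x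
  rw [one_mul]
  exact le_of_eq h

/-- The Haar probability measure on the orthogonal group `O(m)`. -/
def orthHaar : Measure (OrthGroup m) :=
  Measure.haarMeasure (⊤ : TopologicalSpace.PositiveCompacts (OrthGroup m))

end OrthogonalGroup

section Grassmannian

/-- The Grassmannian `𝒢_{m,k}` of `k`-dimensional linear subspaces of `ℝᵐ`. -/
def Grassmannian (m k : ℕ) : Type :=
  {F : Submodule ℝ (Euc m) // Module.finrank ℝ F = k}

variable {m k : ℕ}

/-- The usual topology of the Grassmannian: `F` is identified with the orthogonal projection
`P_F`. -/
instance instTopologicalSpaceGrassmannian : TopologicalSpace (Grassmannian m k) :=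
  TopologicalSpace.induced
    (fun F : Grassmannian m k => (F.1.starProjection : Euc m →L[ℝ] Euc m)) inferInstance

instance instMeasurableSpaceGrassmannian : MeasurableSpace (Grassmannian m k) :=
  borel (Grassmannian m k)

instance instBorelSpaceGrassmannian : BorelSpace (Grassmannian m k) := ⟨rfl⟩

/-- The action of the orthogonal group on the Grassmannian, `(U, F) ↦ U F`. -/
def orthAct (U : OrthGroup m) (F : Grassmannian m k) : Grassmannian m k :=
  ⟨F.1.map (Unitary.linearIsometryEquiv U).toLinearEquiv.toLinearMap,
    (LinearEquiv.finrank_map_eq (Unitary.linearIsometryEquiv U).toLinearEquiv F.1).trans F.2⟩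

/-- The coordinate subspace `span (e₁, …, e_k)` of `ℝᵐ`. -/
def coordSubspace (hk : k ≤ m) : Grassmannian m k :=
  ⟨Submodule.span ℝ (Set.range fun i : Fin k =>
      (EuclideanSpace.single (Fin.castLE hk i) (1 : ℝ) : Euc m)), by
    have h : LinearIndependent ℝ (fun i : Fin k =>
        (EuclideanSpace.single (Fin.castLE hk i) (1 : ℝ) : Euc m)) :=
      ((EuclideanSpace.orthonormal_single (𝕜 := ℝ) (ι := Fin m)).comp _
        (Fin.castLE_injective hk)).linearIndependent
    rw [finrank_span_eq_card h, Fintype.card_fin]⟩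

/-- The Haar measure on the Grassmannian `𝒢_{m,k}`, i.e. its rotation invariant Borel probability
measure: the law of `U span (e₁, …, e_k)` for `U` distributed according to the Haar probability
measure of `O(m)`. -/
def grassHaar (hk : k ≤ m) : Measure (Grassmannian m k) :=
  (orthHaar m).map fun U => orthAct U (coordSubspace hk)

lemma starProjection_orthAct (U : OrthGroup m) (F : Grassmannian m k) :
    (orthAct U F).1.starProjection
      = (U : Euc m →L[ℝ] Euc m) * F.1.starProjection * star (U : Euc m →L[ℝ] Euc m) := by
  ext1 x
  exact Submodule.starProjection_map_apply (Unitary.linearIsometryEquiv U) F.1 x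

/-- The map `U ↦ U F` is continuous, so `grassHaar` is the push-forward of a measure under a
measurable map. -/
lemma continuous_orthAct (F : Grassmannian m k) :
    Continuous fun U : OrthGroup m => orthAct U F := by
  refine continuous_induced_rng.mpr ?_
  have h : ((fun F : Grassmannian m k => (F.1.starProjection : Euc m →L[ℝ] Euc m)) ∘
      fun U : OrthGroup m => orthAct U F) = fun U : OrthGroup m =>
        (U : Euc m →L[ℝ] Euc m) * F.1.starProjection * star (U : Euc m →L[ℝ] Euc m) :=
    funext fun U => starProjection_orthAct U F
  rw [h]
  exact (continuous_subtype_val.mul continuous_const).mul continuous_subtype_val.star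

instance instIsProbabilityMeasureGrassHaar (hk : k ≤ m) :
    IsProbabilityMeasure (grassHaar hk) := by
  have : IsProbabilityMeasure (orthHaar m) := ⟨Measure.haarMeasure_self⟩
  exact Measure.isProbabilityMeasure_map (continuous_orthAct _).measurable.aemeasurable

end Grassmannian

section GaussianParameter

variable {n m : ℕ}

/-- `P_F T`, as a linear map from `ℝⁿ` to `F`. -/
def projComp (T : Euc n →ₗ[ℝ] Euc m) (F : Submodule ℝ (Euc m)) : Euc n →ₗ[ℝ] F :=
  (F.orthogonalProjectionOnto : Euc m →L[ℝ] F).toLinearMap ∘ₗ T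

/-- `det [(P_F T) (P_F T)^*]`, the determinant of an operator on `F`. -/
def gramDet (T : Euc n →ₗ[ℝ] Euc m) (F : Submodule ℝ (Euc m)) : ℝ :=
  LinearMap.det (projComp T F ∘ₗ LinearMap.adjoint (projComp T F))

/-- The parameter `a_k(T)` of a linear map `T : ℝⁿ → ℝᵐ` of rank `m`, where `1 ≤ k ≤ m`:
`(∫ det^{-1/2} [(P_F T) (P_F T)^*] dF)^{-1/k}` over `𝒢_{m,k}` if `k < m`, and
`det^{1/(2m)} (T T^*)` if `k = m`. -/
def aParam (T : Euc n →ₗ[ℝ] Euc m) (k : ℕ) (hk : k ≤ m) : ℝ :=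
  if k = m then LinearMap.det (T ∘ₗ LinearMap.adjoint T) ^ (1 / (2 * (m : ℝ)))
  else (∫ F : Grassmannian m k, gramDet T F.1 ^ (-(1 / 2) : ℝ) ∂(grassHaar hk)) ^ (-(1 / (k : ℝ)))

end GaussianParameter

end SmallBall

end

section

open MeasureTheory Metric Set Filter Topology
open scoped ENNReal

namespace SmallBall

/-! Project at random. For a fixed vector `y`, the mean of `‖P_F y‖²` over the Grassmannian is
`(k/m)‖y‖²`, so by Markov's inequality at least half of the subspaces satisfy `‖P_F y‖ ≤ √(2k/m) r`
whenever `‖y‖ ≤ r`. Taking `y = T X` and exchanging the integrals bounds the probability of `‖T X‖ ≤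
r` by twice the average over `F` of the probability of `‖P_F T X‖ ≤ √(2k/m) r`
(`measure_norm_le_le_lintegral_grassHaar`).

For each fixed `F`, the map `P_F T` is onto `F` and factors through the `k`-dimensional marginal of
`X` on the orthogonal complement of its kernel. The small ball estimate, holding at all centres and
radii, acts as a density bound for this marginal (`measure_le_of_closedBall_le`), hence bounds the
probability of an ellipsoid by its volume. The volume contributes the factor `det^{-1/2}` of the
Gram operator (`measureReal_norm_le_of_smallBallEstimate`), and averaging this factor over `F` gives
exactly `a_k(T)^{-k}`. When `k = m` no averaging is needed. -/

/-- A finite measure dominated on closed balls by a multiple of a locally finite measure is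
dominated by that multiple on all sets. -/
theorem measure_le_of_closedBall_le {E : Type*} [NormedAddCommGroup E] [NormedSpace ℝ E]
    [FiniteDimensional ℝ E] [MeasurableSpace E] [BorelSpace E] (ν lam : Measure E)
    [IsFiniteMeasure ν] [IsFiniteMeasureOnCompacts lam] {C : ℝ≥0∞} (hC : C ≠ ∞)
    (h : ∀ z : E, ∀ ρ : ℝ, 0 < ρ → ν (closedBall z ρ) ≤ C * lam (closedBall z ρ)) (s : Set E) :
    ν s ≤ C * lam s := by
  -- By the Besicovitch covering theorem, `ν`-almost all of `s` is covered by countably many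
  -- disjoint closed balls inside `U`; the hypothesis is then summed over them. Outer regularity of
  -- `lam` replaces `U` by `s`.
  have key : ∀ U : Set E, IsOpen U → s ⊆ U → ν s ≤ C * lam U := by
    intro U hU hsU
    have hR : ∀ x ∈ s, ∃ R : ℝ, 0 < R ∧ closedBall x R ⊆ U := fun x hx =>
      Metric.nhds_basis_closedBall.mem_iff.1 (hU.mem_nhds (hsU hx))
    choose! R hR0 hRU using hR
    obtain ⟨t, r, htc, hts, hr, hcov, hdisj⟩ :=
      Besicovitch.exists_disjoint_closedBall_covering_ae ν (fun _ => univ) s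
        (fun x _ δ hδ => ⟨δ / 2, mem_univ _, by constructor <;> linarith⟩) R hR0
    have hsub : ∀ x ∈ t, closedBall x (r x) ⊆ U := fun x hx =>
      (closedBall_subset_closedBall (hr x hx).2.2.le).trans (hRU x (hts hx))
    calc ν s ≤ ν ((s \ ⋃ x ∈ t, closedBall x (r x)) ∪ ⋃ x ∈ t, closedBall x (r x)) :=
          measure_mono (by rw [sdiff_union_self]; exact subset_union_left)
      _ ≤ ν (⋃ x ∈ t, closedBall x (r x)) := by
          refine (measure_union_le _ _).trans ?_
          rw [hcov, zero_add]
      _ ≤ ∑' x : t, ν (closedBall x.1 (r x.1)) := measure_biUnion_le _ htc _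
      _ ≤ ∑' x : t, C * lam (closedBall x.1 (r x.1)) :=
          ENNReal.tsum_le_tsum fun x => h _ _ (hr x.1 x.2).2.1
      _ = C * lam (⋃ x ∈ t, closedBall x (r x)) := by
          rw [ENNReal.tsum_mul_left, measure_biUnion htc hdisj fun x _ => measurableSet_closedBall]
      _ ≤ C * lam U := by
          gcongr
          exact iUnion₂_subset hsub
  rw [s.measure_eq_iInf_isOpen lam]
  -- Multiplication by `C` commutes with the infimum only for `C ≠ 0`; for `C = 0` the choice `U =
  -- univ` suffices.
  rcases eq_or_ne C 0 with rfl | h0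
  · simpa using key univ isOpen_univ (subset_univ s)
  · simp only [ENNReal.mul_iInf_of_ne h0 hC, le_iInf_iff]
    exact fun U hsU hU => key U hU hsU

/-! ### Small ball estimates under linear surjections -/

/-- The determinant of a real operator equals that of its adjoint. -/
theorem det_adjoint_eq {V : Type*} [NormedAddCommGroup V] [InnerProductSpace ℝ V]
    [FiniteDimensional ℝ V] (f : V →ₗ[ℝ] V) :
    LinearMap.det (LinearMap.adjoint f) = LinearMap.det f := by
  let b := stdOrthonormalBasis ℝ V
  rw [← LinearMap.det_toMatrix b.toBasis, ← LinearMap.det_toMatrix b.toBasis,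
    LinearMap.toMatrix_adjoint, Matrix.det_conjTranspose]
  simp

theorem det_comp_adjoint_eq_sq {V : Type*} [NormedAddCommGroup V] [InnerProductSpace ℝ V]
    [FiniteDimensional ℝ V] (f : V →ₗ[ℝ] V) :
    LinearMap.det (f ∘ₗ LinearMap.adjoint f) = LinearMap.det f ^ 2 := by
  rw [LinearMap.det_comp, det_adjoint_eq, sq]

/-- A surjective map from `E` onto `V` factors, up to the orthogonal projection onto the orthogonal
complement of its kernel and an isometry, through an operator on `V` with the same Gram operator. -/
theorem exists_factor_through_isometry {E V : Type*} [NormedAddCommGroup E] [InnerProductSpace ℝ E]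
    [FiniteDimensional ℝ E] [NormedAddCommGroup V] [InnerProductSpace ℝ V]
    [FiniteDimensional ℝ V] (S : E →ₗ[ℝ] V) (hS : Function.Surjective S) :
    ∃ (G : Submodule ℝ E) (J : V ≃ₗᵢ[ℝ] G) (f : V →ₗ[ℝ] V),
      (∀ x, f (J.symm (G.orthogonalProjectionOnto x)) = S x) ∧
      f ∘ₗ LinearMap.adjoint f = S ∘ₗ LinearMap.adjoint S ∧ LinearMap.det f ≠ 0 := by
  set G := (LinearMap.ker S)ᗮ
  have hdim : Module.finrank ℝ V = Module.finrank ℝ G := by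
    have h1 := LinearMap.finrank_range_add_finrank_ker S
    have h2 := (LinearMap.ker S).finrank_add_finrank_orthogonal
    rw [LinearMap.range_eq_top.2 hS, finrank_top] at h1
    change _ + Module.finrank ℝ G = _ at h2
    omega
  let J : V ≃ₗᵢ[ℝ] G :=
    (stdOrthonormalBasis ℝ V).equiv (stdOrthonormalBasis ℝ G) (finCongr hdim)
  let f : V →ₗ[ℝ] V := S ∘ₗ G.subtype ∘ₗ J.toLinearEquiv.toLinearMap
  have hSP : ∀ x, S (G.orthogonalProjectionOnto x : E) = S x := by
    intro x
    have hx : x - G.starProjection x ∈ Gᗮ := G.sub_starProjection_mem_orthogonal x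
    rw [Submodule.orthogonal_orthogonal, LinearMap.mem_ker, map_sub, sub_eq_zero] at hx
    exact hx.symm
  have hfac : ∀ x, f (J.symm (G.orthogonalProjectionOnto x)) = S x := by
    intro x
    simpa [f] using hSP x
  have hadj : ∀ v, LinearMap.adjoint f v =
      J.symm (G.orthogonalProjectionOnto (LinearMap.adjoint S v)) := by
    intro v
    refine ext_inner_left ℝ fun w => ?_
    rw [LinearMap.adjoint_inner_right, ← J.inner_map_map w, J.apply_symm_apply,
      Submodule.inner_orthogonalProjectionOnto_eq_of_mem_left, LinearMap.adjoint_inner_right]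
    rfl
  refine ⟨G, J, f, hfac, ?_, ?_⟩
  · ext v
    simp only [LinearMap.comp_apply, hadj, hfac]
  · have hsurj : Function.Surjective f := fun v => by
      obtain ⟨x, rfl⟩ := hS v
      exact ⟨_, hfac x⟩
    have := (LinearEquiv.ofBijective f
      ⟨LinearMap.injective_iff_surjective.2 hsurj, hsurj⟩).isUnit_det'
    exact this.ne_zero

/-- The small ball estimate for marginals of dimension `dim V` yields a small ball estimate for
every linear surjection onto `V`. -/
theorem measureReal_norm_le_of_smallBallEstimate {Ω : Type*} [MeasurableSpace Ω] {μ : Measure Ω}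
    [IsProbabilityMeasure μ] {n : ℕ} {X : Ω → Euc n} (hX : AEMeasurable X μ) {L : ℝ} {k : ℕ}
    (hSB : SmallBallEstimate μ X L k) {V : Type*} [NormedAddCommGroup V] [InnerProductSpace ℝ V]
    [FiniteDimensional ℝ V] (hV : Module.finrank ℝ V = k) (hk : 1 ≤ k)
    (S : Euc n →ₗ[ℝ] V) (hS : Function.Surjective S) {r : ℝ} (hr : 0 ≤ r) :
    μ.real {ω | ‖S (X ω)‖ ≤ r} ≤
      L ^ k * (r / √(k : ℝ)) ^ k * LinearMap.det (S ∘ₗ LinearMap.adjoint S) ^ (-(1 / 2) : ℝ) := by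
  obtain ⟨G, J, f, hfac, hgram, hdet⟩ := exists_factor_through_isometry S hS
  have hk0 : 0 < √(k : ℝ) := Real.sqrt_pos.2 (by exact_mod_cast hk)
  have hGk : Module.finrank ℝ G = k := by rw [← hV, J.toLinearEquiv.finrank_eq]
  -- The sign of `L` is not assumed; the estimate at `ε = 1` bounds a probability by `L ^ k`.
  have hLk : 0 ≤ L ^ k := by
    simpa using measureReal_nonneg.trans (hSB G hGk 0 1 one_pos)
  borelize V
  let Y : Euc n → V := fun x => J.symm (G.orthogonalProjectionOnto x)
  have hYc : Continuous Y := by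
    exact J.symm.continuous.comp G.orthogonalProjectionOnto.continuous
  have hYX : AEMeasurable (Y ∘ X) μ := hYc.measurable.comp_aemeasurable hX
  let ν := μ.map (Y ∘ X)
  have : IsProbabilityMeasure ν := Measure.isProbabilityMeasure_map hYX
  let lam : Measure V := Measure.addHaar
  have hb0 : lam (ball 0 1) ≠ 0 := (measure_ball_pos _ _ one_pos).ne'
  have hbT : lam (ball 0 1) ≠ ∞ := measure_ball_lt_top.ne
  let C : ℝ≥0∞ := ENNReal.ofReal (L ^ k / √(k : ℝ) ^ k) / lam (ball 0 1)
  have hC : C ≠ ∞ := ENNReal.div_ne_top ENNReal.ofReal_ne_top hb0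
  have hball : ∀ z : V, ∀ ρ : ℝ, 0 < ρ → ν (closedBall z ρ) ≤ C * lam (closedBall z ρ) := by
    intro z ρ hρ
    have h1 := hSB G hGk (J z : Euc n) (ρ / √(k : ℝ)) (by positivity)
    have hset : (Y ∘ X) ⁻¹' closedBall z ρ =
        {ω | ‖G.starProjection (X ω) - (J z : Euc n)‖ ≤ ρ / √(k : ℝ) * √(k : ℝ)} := by
      ext ω
      rw [div_mul_cancel₀ _ hk0.ne', mem_preimage, mem_closedBall, dist_eq_norm, mem_ofPred_eq,
        ← J.norm_map, map_sub]
      simp only [Function.comp, Y, J.apply_symm_apply]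
      rfl
    rw [Measure.map_apply_of_aemeasurable hYX measurableSet_closedBall, hset,
      Measure.addHaar_closedBall _ _ hρ.le, hV, mul_left_comm, ENNReal.div_mul_cancel hb0 hbT,
      ← ENNReal.ofReal_mul (by positivity)]
    refine (ENNReal.le_ofReal_iff_toReal_le (measure_ne_top _ _) (by positivity)).2 ?_
    refine h1.trans (le_of_eq ?_)
    rw [mul_pow, div_pow]
    ring
  have hmain := measure_le_of_closedBall_le ν lam hC hball (f ⁻¹' closedBall 0 r)
  have hfm : MeasurableSet (f ⁻¹' closedBall (0 : V) r) :=
    (isClosed_closedBall.preimage f.continuous_of_finiteDimensional).measurableSet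
  have hset : (Y ∘ X) ⁻¹' (f ⁻¹' closedBall 0 r) = {ω | ‖S (X ω)‖ ≤ r} := by
    ext ω
    simp [Y, hfac]
  -- Pulling the ball back by `f` multiplies its volume by `|det f|⁻¹`; the volume of the unit ball
  -- cancels against the denominator of `C`.
  rw [Measure.map_apply_of_aemeasurable hYX hfm, hset, Measure.addHaar_preimage_linearMap _ hdet,
    Measure.addHaar_closedBall _ _ hr, hV, mul_left_comm, mul_left_comm C,
    ENNReal.div_mul_cancel hb0 hbT, ← ENNReal.ofReal_mul (by positivity),
    ← ENNReal.ofReal_mul (by positivity)] at hmain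
  have hrp : LinearMap.det (S ∘ₗ LinearMap.adjoint S) ^ (-(1 / 2) : ℝ) = |(LinearMap.det f)⁻¹| := by
    rw [← hgram, det_comp_adjoint_eq_sq, Real.rpow_neg (sq_nonneg _), ← Real.sqrt_eq_rpow,
      Real.sqrt_sq_eq_abs, abs_inv]
  rw [hrp]
  refine ((ENNReal.le_ofReal_iff_toReal_le (measure_ne_top _ _) (by positivity)).1 hmain).trans
    (le_of_eq ?_)
  rw [div_pow]
  ring

/-! ### Random projections and Haar measure on the Grassmannian -/

section Haar

variable {m k : ℕ}

instance instIsProbabilityMeasureOrthHaar (m : ℕ) : IsProbabilityMeasure (orthHaar m) :=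
  ⟨Measure.haarMeasure_self⟩

instance instIsMulLeftInvariantOrthHaar (m : ℕ) : (orthHaar m).IsMulLeftInvariant := by
  unfold orthHaar
  infer_instance

theorem continuous_grassmannian_starProjection :
    Continuous fun F : Grassmannian m k => (F.1.starProjection : Euc m →L[ℝ] Euc m) :=
  continuous_induced_dom

instance instSecondCountableTopologyGrassmannian : SecondCountableTopology (Grassmannian m k) :=
  (Topology.IsInducing.mk rfl : Topology.IsInducing
    fun F : Grassmannian m k => (F.1.starProjection : Euc m →L[ℝ] Euc m)).secondCountableTopology

/-- The Haar measure on the Grassmannian is rotation invariant. -/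
theorem map_orthAct_grassHaar (hk : k ≤ m) (V : OrthGroup m) :
    (grassHaar hk).map (orthAct V) = grassHaar hk := by
  have hV : Continuous (orthAct V : Grassmannian m k → Grassmannian m k) := by
    refine continuous_induced_rng.mpr ?_
    have h : ((fun F : Grassmannian m k => (F.1.starProjection : Euc m →L[ℝ] Euc m)) ∘
        orthAct V) = fun F : Grassmannian m k =>
          (V : Euc m →L[ℝ] Euc m) * F.1.starProjection * star (V : Euc m →L[ℝ] Euc m) :=
      funext fun F => starProjection_orthAct V F
    rw [h]
    exact (continuous_const.mul continuous_grassmannian_starProjection).mul continuous_const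
  have hc := continuous_orthAct (coordSubspace hk)
  have hmul : ∀ U : OrthGroup m, orthAct V (orthAct U (coordSubspace hk)) =
      orthAct (V * U) (coordSubspace hk) := by
    intro U
    apply Subtype.ext
    simp only [orthAct, ← Submodule.map_comp]
    rfl
  unfold grassHaar
  rw [Measure.map_map hV.measurable hc.measurable]
  conv_rhs => rw [← map_mul_left_eq_self (orthHaar m) V]
  rw [Measure.map_map hc.measurable (measurable_const_mul V)]
  exact congrArg (fun g => Measure.map g (orthHaar m)) (funext hmul)

theorem continuous_norm_starProjection_sq (y : Euc m) :
    Continuous fun F : Grassmannian m k => ‖F.1.starProjection y‖ ^ 2 :=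
  (((ContinuousLinearMap.apply ℝ (Euc m) y).continuous.comp
    continuous_grassmannian_starProjection).norm).pow 2

theorem integrable_norm_starProjection_sq (hk : k ≤ m) (y : Euc m) :
    Integrable (fun F : Grassmannian m k => ‖F.1.starProjection y‖ ^ 2) (grassHaar hk) := by
  refine Integrable.of_bound (continuous_norm_starProjection_sq y).aestronglyMeasurable (‖y‖ ^ 2)
    (ae_of_all _ fun F => ?_)
  rw [Real.norm_of_nonneg (by positivity)]
  gcongr
  exact F.1.norm_starProjection_apply_le y

/-- The reflection in the hyperplane orthogonal to `z - y` exchanges the two vectors. -/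
theorem exists_orthGroup_apply_eq {y z : Euc m} (h : ‖y‖ = ‖z‖) :
    ∃ V : OrthGroup m, (V : Euc m →L[ℝ] Euc m) z = y := by
  refine ⟨Unitary.linearIsometryEquiv.symm (Submodule.reflection (ℝ ∙ (z - y))ᗮ), ?_⟩
  exact Submodule.reflection_sub h.symm

theorem integral_norm_starProjection_sq_congr (hk : k ≤ m) {y z : Euc m} (h : ‖y‖ = ‖z‖) :
    ∫ F : Grassmannian m k, ‖F.1.starProjection y‖ ^ 2 ∂(grassHaar hk) =
      ∫ F : Grassmannian m k, ‖F.1.starProjection z‖ ^ 2 ∂(grassHaar hk) := by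
  obtain ⟨V, rfl⟩ := exists_orthGroup_apply_eq h
  -- The push-forward under a non-measurable map is zero by convention, which invariance of a
  -- probability measure excludes.
  have hVm : AEMeasurable (orthAct V : Grassmannian m k → Grassmannian m k) (grassHaar hk) := by
    by_contra hn
    have h0 := map_orthAct_grassHaar hk V
    rw [Measure.map_of_not_aemeasurable hn] at h0
    exact (IsProbabilityMeasure.ne_zero (grassHaar hk)) h0.symm
  conv_lhs => rw [← map_orthAct_grassHaar hk V]
  rw [integral_map hVm (continuous_norm_starProjection_sq _).aestronglyMeasurable]
  refine integral_congr_ae (ae_of_all _ fun F => ?_)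
  have h1 : star (V : Euc m →L[ℝ] Euc m) ((V : Euc m →L[ℝ] Euc m) z) = z := by
    rw [← mul_apply_eq_comp, Unitary.coe_star_mul_self]
    rfl
  simp only [starProjection_orthAct, mul_apply_eq_comp, h1]
  exact congrArg (· ^ 2) ((Unitary.linearIsometryEquiv V).norm_map _)

/-- Both sides are the trace of `P_F`, since `⟪P_F e, e⟫ = ‖P_F e‖²`. -/
theorem sum_norm_starProjection_single_sq (F : Grassmannian m k) :
    ∑ i : Fin m, ‖F.1.starProjection (EuclideanSpace.single i (1 : ℝ))‖ ^ 2 = k := by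
  have hproj : LinearMap.IsProj F.1 (F.1.starProjection : Euc m →L[ℝ] Euc m).toLinearMap :=
    ⟨fun x => F.1.starProjection_apply_mem x,
      fun x hx => Submodule.starProjection_eq_self_iff.2 hx⟩
  have htr := hproj.trace
  rw [F.2, LinearMap.trace_eq_sum_inner _ (EuclideanSpace.basisFun (Fin m) ℝ)] at htr
  rw [← htr]
  refine Finset.sum_congr rfl fun i _ => ?_
  have h0 := F.1.starProjection_inner_eq_zero (EuclideanSpace.single i (1 : ℝ)) _
    (F.1.starProjection_apply_mem (EuclideanSpace.single i (1 : ℝ)))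
  rw [inner_sub_left, real_inner_self_eq_norm_sq, sub_eq_zero] at h0
  rw [EuclideanSpace.basisFun_apply, ContinuousLinearMap.coe_coe, h0]

/-- The average of `‖P_F y‖²` over the Grassmannian. -/
theorem integral_norm_starProjection_sq (hk : k ≤ m) (y : Euc m) :
    m * ∫ F : Grassmannian m k, ‖F.1.starProjection y‖ ^ 2 ∂(grassHaar hk) = k * ‖y‖ ^ 2 := by
  -- By invariance the mean depends only on the norm of the vector, so `y` can be compared with
  -- every basis vector and the results summed.
  have hi : ∀ i : Fin m, ∫ F : Grassmannian m k, ‖F.1.starProjection y‖ ^ 2 ∂(grassHaar hk) =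
      ‖y‖ ^ 2 * ∫ F : Grassmannian m k,
        ‖F.1.starProjection (EuclideanSpace.single i (1 : ℝ))‖ ^ 2 ∂(grassHaar hk) := by
    intro i
    have hn : ‖y‖ = ‖‖y‖ • (EuclideanSpace.single i (1 : ℝ) : Euc m)‖ := by simp [norm_smul]
    rw [integral_norm_starProjection_sq_congr hk hn, ← integral_const_mul]
    simp [norm_smul, mul_pow]
  have hs : ∑ i : Fin m, ∫ F : Grassmannian m k,
      ‖F.1.starProjection (EuclideanSpace.single i (1 : ℝ))‖ ^ 2 ∂(grassHaar hk) = k := by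
    rw [← integral_finsetSum _ fun i _ => integrable_norm_starProjection_sq hk _,
      integral_congr_ae (ae_of_all _ sum_norm_starProjection_single_sq)]
    simp
  have hsum := Finset.sum_congr (rfl : (Finset.univ : Finset (Fin m)) = _) fun i _ => hi i
  rw [← Finset.mul_sum, hs, Finset.sum_const, Finset.card_univ, Fintype.card_fin,
    nsmul_eq_mul] at hsum
  rw [hsum, mul_comm]

/-- With probability at least `1/2`, a random projection shrinks norms by the factor `√(k/m)`
up to a constant. -/
theorem half_le_grassHaar_norm_starProjection_le (hk : k ≤ m) (hk1 : 1 ≤ k) {y : Euc m} {r : ℝ}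
    (hr : 0 < r) (hy : ‖y‖ ≤ r) :
    1 ≤ 2 * grassHaar hk {F : Grassmannian m k | ‖F.1.starProjection y‖ ≤ √(2 * k / m) * r} := by
  set A := {F : Grassmannian m k | ‖F.1.starProjection y‖ ≤ √(2 * k / m) * r}
  have hm0 : (0 : ℝ) < m := by exact_mod_cast hk1.trans hk
  have hk0 : (0 : ℝ) < k := by exact_mod_cast hk1
  -- Twice the upper bound `(k/m) r²` for the mean, so that Markov's inequality gives `1/2`.
  set t : ℝ := 2 * k / m * r ^ 2
  have ht : 0 < t := by positivity
  have hmark := mul_meas_ge_le_integral_of_nonneg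
    (ae_of_all (grassHaar hk) fun F => sq_nonneg ‖F.1.starProjection y‖)
    (integrable_norm_starProjection_sq hk y) t
  have hint : ∫ F : Grassmannian m k, ‖F.1.starProjection y‖ ^ 2 ∂(grassHaar hk) ≤ t / 2 := by
    refine le_of_mul_le_mul_left ?_ hm0
    rw [integral_norm_starProjection_sq]
    calc (k : ℝ) * ‖y‖ ^ 2 ≤ k * r ^ 2 := by gcongr
      _ = m * (t / 2) := by simp only [t]; field_simp
  have hAm : MeasurableSet A :=
    (isClosed_le ((ContinuousLinearMap.apply ℝ (Euc m) y).continuous.comp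
      continuous_grassmannian_starProjection).norm continuous_const).measurableSet
  have hsub : Aᶜ ⊆ {F : Grassmannian m k | t ≤ ‖F.1.starProjection y‖ ^ 2} := by
    intro F hF
    have hF' : √(2 * k / m) * r < ‖F.1.starProjection y‖ := not_le.1 hF
    have h2 : t = (√(2 * k / m) * r) ^ 2 := by
      rw [mul_pow, Real.sq_sqrt (by positivity)]
    change t ≤ _
    rw [h2]
    gcongr
  have hc : (grassHaar hk).real Aᶜ ≤ 1 / 2 := by
    have h3 : t * (grassHaar hk).real Aᶜ ≤ t * (1 / 2) := by
      calc t * (grassHaar hk).real Aᶜ ≤ t * _ := mul_le_mul_of_nonneg_left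
            (measureReal_mono hsub) ht.le
        _ ≤ _ := hmark
        _ ≤ t / 2 := hint
        _ = t * (1 / 2) := by ring
    exact le_of_mul_le_mul_left h3 ht
  rw [probReal_compl_eq_one_sub hAm] at hc
  have h4 : (1 : ℝ) ≤ 2 * (grassHaar hk).real A := by linarith
  have h5 := ENNReal.ofReal_le_ofReal h4
  rwa [ENNReal.ofReal_mul zero_le_two, ofReal_measureReal, ENNReal.ofReal_one,
    ENNReal.ofReal_ofNat] at h5

end Haar

/-! ### Gram determinants as functions of the subspace -/

theorem det_one_add_comp_comm {V W : Type*} [AddCommGroup V] [Module ℝ V] [FiniteDimensional ℝ V]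
    [AddCommGroup W] [Module ℝ W] [FiniteDimensional ℝ W] (f : V →ₗ[ℝ] W) (g : W →ₗ[ℝ] V) :
    LinearMap.det (1 + f ∘ₗ g) = LinearMap.det (1 + g ∘ₗ f) := by
  let b := Module.finBasis ℝ V
  let c := Module.finBasis ℝ W
  rw [← LinearMap.det_toMatrix c, ← LinearMap.det_toMatrix b, map_add, map_add,
    LinearMap.toMatrix_comp c b c, LinearMap.toMatrix_comp b c b, LinearMap.toMatrix_one,
    LinearMap.toMatrix_one, Matrix.det_one_add_mul_comm]

variable {n m k : ℕ}

/-- Sylvester's identity moves the determinant from the varying space `F` to the fixed space `ℝᵐ`,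
where continuity in `P_F` is visible. -/
theorem gramDet_eq_det_one_add (T : Euc n →ₗ[ℝ] Euc m) (F : Submodule ℝ (Euc m)) :
    gramDet T F = LinearMap.det
      (1 + (T ∘ₗ LinearMap.adjoint T - 1) ∘ₗ (F.starProjection : Euc m →L[ℝ] Euc m).toLinearMap) := by
  set A : Euc m →ₗ[ℝ] Euc m := T ∘ₗ LinearMap.adjoint T
  let P : Euc m →ₗ[ℝ] F := (F.orthogonalProjectionOnto : Euc m →L[ℝ] F).toLinearMap
  have hadj : LinearMap.adjoint (projComp T F) = LinearMap.adjoint T ∘ₗ F.subtype := by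
    refine ((LinearMap.eq_adjoint_iff _ _).2 fun x y => ?_).symm
    rw [LinearMap.comp_apply, LinearMap.adjoint_inner_left]
    exact (Submodule.inner_orthogonalProjectionOnto_eq_of_mem_left x (T y)).symm
  have h1 : projComp T F ∘ₗ LinearMap.adjoint (projComp T F) =
      1 + P ∘ₗ ((A - 1) ∘ₗ F.subtype) := by
    rw [hadj]
    ext1 x
    have hx : P x = x := F.orthogonalProjectionOnto_mem_subspace_eq_self x
    simp only [LinearMap.comp_apply, LinearMap.add_apply, LinearMap.sub_apply, Module.End.one_apply,
      map_sub, Submodule.subtype_apply, hx, A]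
    exact (add_sub_cancel _ _).symm
  rw [gramDet, h1, det_one_add_comp_comm]
  rfl

theorem continuous_gramDet (T : Euc n →ₗ[ℝ] Euc m) :
    Continuous fun F : Grassmannian m k => gramDet T F.1 := by
  have h : (fun F : Grassmannian m k => gramDet T F.1) = fun F : Grassmannian m k =>
      (1 + LinearMap.toContinuousLinearMap (T ∘ₗ LinearMap.adjoint T - 1) *
        F.1.starProjection : Euc m →L[ℝ] Euc m).det := by
    funext F
    rw [gramDet_eq_det_one_add]
    rfl
  rw [h]
  exact ContinuousLinearMap.continuous_det.comp
    (continuous_const.add (continuous_const.mul continuous_induced_dom))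

theorem projComp_surjective {T : Euc n →ₗ[ℝ] Euc m} (hT : Function.Surjective T)
    (F : Submodule ℝ (Euc m)) : Function.Surjective (projComp T F) := by
  intro v
  obtain ⟨x, hx⟩ := hT v
  refine ⟨x, ?_⟩
  rw [projComp, LinearMap.comp_apply, hx]
  exact F.orthogonalProjectionOnto_mem_subspace_eq_self v

theorem det_comp_adjoint_pos {E V : Type*} [NormedAddCommGroup E] [InnerProductSpace ℝ E]
    [FiniteDimensional ℝ E] [NormedAddCommGroup V] [InnerProductSpace ℝ V]
    [FiniteDimensional ℝ V] {S : E →ₗ[ℝ] V} (hS : Function.Surjective S) :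
    0 < LinearMap.det (S ∘ₗ LinearMap.adjoint S) := by
  obtain ⟨G, J, f, -, hgram, hdet⟩ := exists_factor_through_isometry S hS
  rw [← hgram, det_comp_adjoint_eq_sq]
  positivity

/-- Surjectivity of `T` keeps the determinant positive, so its powers are continuous; pulled back to
the compact group `O(m)` they are integrable. -/
theorem integrable_gramDet_rpow {T : Euc n →ₗ[ℝ] Euc m} (hT : Function.Surjective T)
    (hk : k ≤ m) (p : ℝ) :
    Integrable (fun F : Grassmannian m k => gramDet T F.1 ^ p) (grassHaar hk) := by
  have hcont : Continuous fun F : Grassmannian m k => gramDet T F.1 ^ p :=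
    (continuous_gramDet T).rpow_const fun F =>
      Or.inl (det_comp_adjoint_pos (projComp_surjective hT F.1)).ne'
  have : IsProbabilityMeasure (orthHaar m) := ⟨Measure.haarMeasure_self⟩
  have hc := continuous_orthAct (coordSubspace hk)
  rw [grassHaar, integrable_map_measure hcont.aestronglyMeasurable hc.aemeasurable]
  exact (hcont.comp hc).integrable_of_hasCompactSupport (HasCompactSupport.of_compactSpace _)

theorem integral_gramDet_rpow_pos {T : Euc n →ₗ[ℝ] Euc m} (hT : Function.Surjective T)
    (hk : k ≤ m) (p : ℝ) :
    0 < ∫ F : Grassmannian m k, gramDet T F.1 ^ p ∂(grassHaar hk) := by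
  have hpos : ∀ F : Grassmannian m k, 0 < gramDet T F.1 ^ p := fun F =>
    Real.rpow_pos_of_pos (det_comp_adjoint_pos (projComp_surjective hT F.1)) p
  rw [integral_pos_iff_support_of_nonneg (fun F => (hpos F).le) (integrable_gramDet_rpow hT hk p),
    show Function.support (fun F : Grassmannian m k => gramDet T F.1 ^ p) = univ from
      eq_univ_of_forall fun F => (hpos F).ne', measure_univ]
  exact one_pos

/-! ### Averaging over subspaces and the normalization by `a_k(T)` -/

/-- A vector whose image under `T` is small has small projected image for at least half of the
subspaces; averaged over the law of `X`. -/
theorem measure_norm_le_le_lintegral_grassHaar {Ω : Type*} [MeasurableSpace Ω] {μ : Measure Ω}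
    [IsProbabilityMeasure μ] {n m k : ℕ} {X : Ω → Euc n} (hX : AEMeasurable X μ)
    (T : Euc n →ₗ[ℝ] Euc m) (hk : k ≤ m) (hk1 : 1 ≤ k) {r : ℝ} (hr : 0 < r) :
    μ {ω | ‖T (X ω)‖ ≤ r} ≤ 2 * ∫⁻ F : Grassmannian m k,
      μ {ω | ‖projComp T F.1 (X ω)‖ ≤ √(2 * k / m) * r} ∂(grassHaar hk) := by
  set s := √(2 * k / m) * r
  have hT : Continuous T := T.continuous_of_finiteDimensional
  let ν := μ.map X
  have : IsProbabilityMeasure ν := Measure.isProbabilityMeasure_map hX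
  let A : Set (Euc n × Grassmannian m k) := {p | ‖p.2.1.starProjection (T p.1)‖ ≤ s}
  have hA : MeasurableSet A :=
    (isClosed_le ((continuous_grassmannian_starProjection.comp continuous_snd).clm_apply
      (hT.comp continuous_fst)).norm continuous_const).measurableSet
  have hB : MeasurableSet {x : Euc n | ‖T x‖ ≤ r} :=
    (isClosed_le hT.norm continuous_const).measurableSet
  have hAF : ∀ F : Grassmannian m k,
      ν ((fun x => (x, F)) ⁻¹' A) = μ {ω | ‖projComp T F.1 (X ω)‖ ≤ s} := fun F =>
    Measure.map_apply_of_aemeasurable hX (measurable_prodMk_right hA)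
  have hAx : Measurable fun x => grassHaar hk (Prod.mk x ⁻¹' A) := measurable_measure_prodMk_left hA
  have hind : ∀ x, {x : Euc n | ‖T x‖ ≤ r}.indicator (1 : Euc n → ℝ≥0∞) x ≤
      2 * grassHaar hk (Prod.mk x ⁻¹' A) := by
    intro x
    by_cases hx : ‖T x‖ ≤ r
    · rw [indicator_of_mem (mem_ofPred_eq ▸ hx), Pi.one_apply]
      have h := half_le_grassHaar_norm_starProjection_le hk hk1 hr hx
      exact h
    · rw [indicator_of_notMem (mem_ofPred_eq ▸ hx)]
      exact zero_le
  calc μ {ω | ‖T (X ω)‖ ≤ r} = ν {x | ‖T x‖ ≤ r} :=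
        (Measure.map_apply_of_aemeasurable hX hB).symm
    _ ≤ ∫⁻ x, 2 * grassHaar hk (Prod.mk x ⁻¹' A) ∂ν := by
        rw [← lintegral_indicator_one hB]
        exact lintegral_mono hind
    _ = 2 * (ν.prod (grassHaar hk)) A := by
        rw [lintegral_const_mul _ hAx, Measure.prod_apply hA]
    _ = _ := by
        rw [Measure.prod_apply_symm hA]
        simp only [hAF]

/-- The parameter `a_k(T)` normalizes the average of the Gram determinants. -/
theorem aParam_pow_mul_integral {n m k : ℕ} {T : Euc n →ₗ[ℝ] Euc m} (hT : Function.Surjective T)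
    (hk : k ≤ m) (hkm : k ≠ m) (hk1 : 1 ≤ k) :
    0 < aParam T k hk ∧ aParam T k hk ^ k *
      ∫ F : Grassmannian m k, gramDet T F.1 ^ (-(1 / 2) : ℝ) ∂(grassHaar hk) = 1 := by
  have hI := integral_gramDet_rpow_pos hT hk (-(1 / 2))
  have hk0 : (k : ℝ) ≠ 0 := by exact_mod_cast (by omega : k ≠ 0)
  rw [aParam, if_neg hkm]
  refine ⟨Real.rpow_pos_of_pos hI _, ?_⟩
  rw [← Real.rpow_natCast, ← Real.rpow_mul hI.le, neg_mul, one_div_mul_cancel hk0,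
    Real.rpow_neg_one, inv_mul_cancel₀ hI.ne']

theorem aParam_self_pow_mul {n m : ℕ} {T : Euc n →ₗ[ℝ] Euc m} (hT : Function.Surjective T)
    (hm : 1 ≤ m) :
    0 < aParam T m le_rfl ∧ aParam T m le_rfl ^ m *
      LinearMap.det (T ∘ₗ LinearMap.adjoint T) ^ (-(1 / 2) : ℝ) = 1 := by
  have hD := det_comp_adjoint_pos hT
  have hm0 : (m : ℝ) ≠ 0 := by exact_mod_cast (by omega : m ≠ 0)
  rw [aParam, if_pos rfl]
  refine ⟨Real.rpow_pos_of_pos hD _, ?_⟩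
  rw [← Real.rpow_natCast, ← Real.rpow_mul hD.le, ← Real.rpow_add hD]
  have : 1 / (2 * (m : ℝ)) * m + -(1 / 2) = 0 := by
    field_simp
    norm_num
  rw [this, Real.rpow_zero]

theorem measureReal_norm_le_of_lt {Ω : Type*} [MeasurableSpace Ω] {μ : Measure Ω}
    [IsProbabilityMeasure μ] {n m k : ℕ} {X : Ω → Euc n} (hX : AEMeasurable X μ) {L : ℝ}
    (hSB : SmallBallEstimate μ X L k) (hL : 0 ≤ L ^ k) {T : Euc n →ₗ[ℝ] Euc m}
    (hT : Function.Surjective T)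
    (hk : k ≤ m) (hkm : k ≠ m) (hk1 : 1 ≤ k) {ε : ℝ} (hε : 0 < ε) :
    μ.real {ω | ‖T (X ω)‖ ≤ ε * √(m : ℝ) * aParam T k hk} ≤ 2 * (√2 ^ k * L ^ k * ε ^ k) := by
  obtain ⟨ha, haI⟩ := aParam_pow_mul_integral hT hk hkm hk1
  set a := aParam T k hk
  have hm0 : 0 < (m : ℝ) := by exact_mod_cast hk1.trans hk
  have hk0 : 0 < (k : ℝ) := by exact_mod_cast hk1
  set r := ε * √(m : ℝ) * a
  have hr : 0 < r := by positivity
  set s := √(2 * k / m) * r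
  -- The dimensional factors cancel: `√(2k/m) · √m / √k = √2`.
  have hsr : s / √(k : ℝ) = √2 * ε * a := by
    have : √(2 * k / m : ℝ) = √2 * √(k : ℝ) / √(m : ℝ) := by
      rw [Real.sqrt_div (by positivity), Real.sqrt_mul (by positivity)]
    simp only [s, r, this]
    field_simp
  set K := L ^ k * (√2 * ε * a) ^ k
  have hK : 0 ≤ K := by positivity
  have hpt : ∀ F : Grassmannian m k, μ {ω | ‖projComp T F.1 (X ω)‖ ≤ s} ≤
      ENNReal.ofReal (K * gramDet T F.1 ^ (-(1 / 2) : ℝ)) := by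
    intro F
    have h := measureReal_norm_le_of_smallBallEstimate hX hSB F.2 hk1 (projComp T F.1)
      (projComp_surjective hT F.1) (r := s) (by positivity)
    rw [hsr] at h
    rw [← ofReal_measureReal]
    exact ENNReal.ofReal_le_ofReal h
  have hnn : ∀ F : Grassmannian m k, 0 ≤ K * gramDet T F.1 ^ (-(1 / 2) : ℝ) := fun F =>
    mul_nonneg hK (Real.rpow_nonneg (det_comp_adjoint_pos (projComp_surjective hT F.1)).le _)
  have h2 : ∀ y : ℝ, 2 * ENNReal.ofReal y = ENNReal.ofReal (2 * y) := fun y => by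
    rw [ENNReal.ofReal_mul zero_le_two, ENNReal.ofReal_ofNat]
  have hle := (measure_norm_le_le_lintegral_grassHaar hX T hk hk1 hr).trans
    (mul_le_mul_right (lintegral_mono hpt) 2)
  rw [← ofReal_integral_eq_lintegral_ofReal ((integrable_gramDet_rpow hT hk _).const_mul K)
    (ae_of_all _ hnn), integral_const_mul, h2] at hle
  refine (ENNReal.toReal_le_of_le_ofReal (mul_nonneg zero_le_two
    (mul_nonneg hK (integral_gramDet_rpow_pos hT hk _).le)) hle).trans (le_of_eq ?_)
  simp only [K]
  rw [mul_pow, mul_pow]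
  linear_combination 2 * √2 ^ k * L ^ k * ε ^ k * haI

theorem measureReal_norm_le_of_eq {Ω : Type*} [MeasurableSpace Ω] {μ : Measure Ω}
    [IsProbabilityMeasure μ] {n m : ℕ} {X : Ω → Euc n} (hX : AEMeasurable X μ) {L : ℝ}
    (hSB : SmallBallEstimate μ X L m) {T : Euc n →ₗ[ℝ] Euc m} (hT : Function.Surjective T)
    (hm : 1 ≤ m) {ε : ℝ} (hε : 0 < ε) :
    μ.real {ω | ‖T (X ω)‖ ≤ ε * √(m : ℝ) * aParam T m le_rfl} ≤ L ^ m * ε ^ m := by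
  obtain ⟨ha, haI⟩ := aParam_self_pow_mul hT hm
  have hm0 : 0 < (m : ℝ) := by exact_mod_cast hm
  refine (measureReal_norm_le_of_smallBallEstimate hX hSB finrank_euclideanSpace_fin hm T hT
    (by positivity)).trans (le_of_eq ?_)
  have : ε * √(m : ℝ) * aParam T m le_rfl / √(m : ℝ) = ε * aParam T m le_rfl := by
    field_simp
  rw [this, mul_pow]
  linear_combination L ^ m * ε ^ m * haI

end SmallBall

end

/-! ### The main estimate -/

theorem corollary1p7 :
    ∃ c : ℝ, 0 < c ∧
      ∀ (Ω : Type*) [MeasurableSpace Ω] (μ : Measure Ω) [IsProbabilityMeasure μ]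
        (n m : ℕ) (X : Ω → SmallBall.Euc n) (L : ℝ)
        (T : SmallBall.Euc n →ₗ[ℝ] SmallBall.Euc m) (k : ℕ) (hkm : k ≤ m),
        AEMeasurable X μ →
        SmallBall.SBA μ X L →
        Module.finrank ℝ (LinearMap.range T) = m →
        1 ≤ k →
        (k = n → SmallBall.SmallBallEstimate μ X L n) →
        ∀ ε : ℝ, 0 < ε →
          μ.real {ω | ‖T (X ω)‖ ≤ ε * √(m : ℝ) * SmallBall.aParam T k hkm} ≤ (c * L * ε) ^ k := by
  -- The factor `√2` comes from the radius in Markov's inequality, and the prefactor `2` from the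
  -- half of the subspaces is absorbed using `2 ≤ 2 ^ k`.
  refine ⟨2 * √2, by positivity, ?_⟩
  intro Ω _ μ _ n m X L T k hkm hX hSBA hrank hk1 hkn ε hε
  have hT : Function.Surjective T := LinearMap.range_eq_top.1
    (Submodule.eq_top_of_finrank_eq (hrank.trans finrank_euclideanSpace_fin.symm))
  have hmn : m ≤ n := by
    have h := T.finrank_range_le
    rwa [hrank, finrank_euclideanSpace_fin] at h
  -- Since `k ≤ m ≤ n`, the equality `k = n` forces `k = m = n`, the only case outside the SBA.
  have hSB : SmallBall.SmallBallEstimate μ X L k := by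
    rcases (hkm.trans hmn).lt_or_eq with h | rfl
    · exact hSBA k hk1 h
    · exact hkn rfl
  have hL : 0 ≤ L ^ k := by
    obtain ⟨F, hF⟩ := SmallBall.coordSubspace (hkm.trans hmn)
    simpa using measureReal_nonneg.trans (hSB F hF 0 1 one_pos)
  have hs : (1 : ℝ) ≤ √2 ^ k := one_le_pow₀ (Real.one_le_sqrt.2 one_le_two)
  have h2 : (2 : ℝ) ≤ 2 ^ k := le_self_pow₀ one_le_two (by omega)
  rw [mul_pow, mul_pow, mul_pow]
  rcases eq_or_ne k m with rfl | hne
  · refine (SmallBall.measureReal_norm_le_of_eq hX hSB hT hk1 hε).trans ?_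
    have h1 : 1 ≤ (2 : ℝ) ^ k * √2 ^ k := by nlinarith
    have := mul_le_mul_of_nonneg_right h1 (mul_nonneg hL (pow_pos hε k).le)
    linarith
  · refine (SmallBall.measureReal_norm_le_of_lt hX hSB hL hT hkm hne hk1 hε).trans ?_
    have := mul_le_mul_of_nonneg_right h2
      (mul_nonneg (mul_nonneg (zero_le_one.trans hs) hL) (pow_pos hε k).le)
    linarith
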